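/- Setting. Let $F$ be a distribution on $[0,\infty)$ with a probability density $f$ such that $E:=\mathbb E_{\tau\sim F}[f(\tau)]<\infty$, let $p_\epsilon\in[0,1]$, $N\ge 0$, $t_s\le t_e$, $T=t_e-t_s$, and let $S$ be a sequence of $N$ events at times $t_s\le t_1\le\dots\le t_N\le t_e$. In the generative model, the number $K$ of intrusion events is $\mathrm{Binomial}(N,p_\epsilon)$, given $K$ all $K$-element subsequences $I$ of $S$ are equally likely to be the intrusion, and the other $N-K$ events of $S$, at indices $k_1<\dots<k_{N-K}$, together with one extra event before and one extra event after the window $[t_s,t_e]$, are $N-K+2$ consecutive events of a renewal process: the $N-K+1$ intervals between them are independent with distribution $F$, and the time of the earliest event, determined only up to a shift, is distributed according to Lebesgue measure. So $n+1$ consecutive events at $s_0,\dots,s_n$ have joint density $\prod_{i=1}^n f(s_i-s_{i-1})$ with respect to Lebesgue measure. The unnormalized posterior probability of $I$ is $$\widetilde\Pr(I|S)=\frac{\Pr(I)\cdot D_I\cdot \mathbb E_{\tau_1,\dots,\tau_K\sim F\text{ i.i.d.}}\big[\prod_{i=1}^K f(\tau_i)\big]}{E^{N+1}},$$ where $\Pr(I)$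 is the prior probability of $I$; $D_I$ is the expected joint density of the $N-K+1$ intervals between consecutive events of $S\setminus I$ and the two extra events, given the times of the events in $S\setminus I$ and that the extra events lie outside the window (i.e. the expectation of the joint density over the times $x\le t_s$ and $y\ge t_e$ of the extra events, whose conditional density is proportional to this joint density); and the last expectation is the expected joint density of $K$ unobserved intervals. Conditional expectations given null events, and quotients $0/0$, are read as $0$. Statement. For $N=K$ set $k_1=N+1$ and $k_{N-K}=k_0=0$. Then, for every subsequence $I$ of $S$ (where for $I=S$ it is also assumed that $\mathbb E_{\tau\sim F}[\tau]$ and $\mathbb E_{\tau\sim F}[\tau f(\tau)]$ are finite), $$\widetilde\Pr(I|S)=P_{k_1}\cdot\prod_{j=1}^{N-K-1}Q_{k_j,k_{j+1}}\cdot R_{k_{N-K}},$$ where $$P_k=E^{-1}\cdot\begin{cases}p_\epsilon^N\,\dfrac{\int_T^\infty(\tau-T)f(\tau)^2\,d\tau}{\int_T^\infty(\tau-T)f(\tau)\,d\tau}&\text{if }k=N+1,\\[2ex] p_\epsilon^{k-1}\,\dfrac{\int_{t_k-t_s}^\infty f(\tau)^2\,d\tau}{\int_{t_k-t_s}^\infty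 f(\tau)\,d\tau}&\text{otherwise,}\end{cases}$$ $$Q_{k,l}=E^{-1}(1-p_\epsilon)\,p_\epsilon^{\,l-k-1}f(t_l-t_k),$$ $$R_k=E^{-1}\cdot\begin{cases}E&\text{if }k=0,\\ (1-p_\epsilon)\,p_\epsilon^{N-k}\,\dfrac{\int_{t_e-t_k}^\infty f(\tau)^2\,d\tau}{\int_{t_e-t_k}^\infty f(\tau)\,d\tau}&\text{otherwise.}\end{cases}$$ The factors correspond to transitions in the generative model: for $1\le k\le N$, the quotients in $P_k$ and $R_k$ are the conditional expectations of $f(\tau)$, $\tau\sim F$, given $\tau\ge t_k-t_s$ and given $\tau\ge t_e-t_k$ (the interval from the extra event at the beginning to the event at $t_k$, and from it to the extra event at the end). If $\mathbb E_{\tau\sim F}[\tau]<\infty$, the interval between consecutive events of the renewal process that covers $[t_s,t_e]$ has length $\tau$ with density $(\tau-T)f(\tau)/\int_T^\infty(\sigma-T)f(\sigma)\,d\sigma$ on $[T,\infty)$, and, if also $\mathbb E_{\tau\sim F}[\tau f(\tau)]<\infty$, the quotient in $P_{N+1}$ is the expectation of $f(\tau)$ under this density. -/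

import Mathlib

open MeasureTheory Set

noncomputable section

namespace Intrusion

/-- `f` is a probability density (with respect to Lebesgue measure) of a non-negative interarrival
interval. -/
structure IsIntervalDensity (f : ℝ → ℝ) : Prop where
  measurable : Measurable f
  nonneg : ∀ τ, 0 ≤ f τ
  eq_zero_of_neg : ∀ τ < 0, f τ = 0
  lintegral_eq_one : ∫⁻ τ, ENNReal.ofReal (f τ) = 1

/-- The distribution `F` of one interarrival interval, with density `f`. -/
def intervalLaw (f : ℝ → ℝ) : Measure ℝ :=
  volume.withDensity fun τ => ENNReal.ofReal (f τ)

/-- The expected density `E_{τ ∼ F} [f(τ)]` of a random interval. -/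
def meanDensity (f : ℝ → ℝ) : ℝ := ∫ τ, f τ ∂intervalLaw f

/-! ### The generative model -/

/-- The prior probability that `I` is the set of indices of intrusion events among `{1, …, N}`: the
size `K` of this set is binomial with parameters `N` and `p`, and given `K` all `K`-element subsets
of `{1, …, N}` are equally likely. -/
def priorProb (p : unitInterval) (N : ℕ) (I : Finset ℕ) : ℝ :=
  if I ⊆ Finset.Icc 1 N then
    (ProbabilityTheory.binomial N p).real {I.card} *
      ((Finset.powersetCard I.card (Finset.Icc 1 N)).card : ℝ)⁻¹
  else 0

/-- The times `c, c + Δ₁, c + Δ₁ + Δ₂, …` of `n + 1` consecutive process events with intervals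
`Δ₁, …, Δₙ`, the earliest of them at `c`. -/
def eventTimes {n : ℕ} (c : ℝ) (Δ : Fin n → ℝ) : Fin (n + 1) → ℝ :=
  fun i => c + ∑ j ∈ Finset.univ.filter (fun j : Fin n => (j : ℕ) < (i : ℕ)), Δ j

/-- The generative model of `n + 1` consecutive process events (two extra events included): the
intervals are independent with distribution `F`, and the time of the earliest event, which is only
determined up to a shift of the time axis, is distributed according to Lebesgue measure. -/
def renewalLaw (f : ℝ → ℝ) (n : ℕ) : Measure (Fin (n + 1) → ℝ) :=
  ((volume : Measure ℝ).prod (Measure.pi fun _ : Fin n => intervalLaw f)).map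
    fun q => eventTimes q.1 q.2

/-- The joint density of the intervals between the `n + 1` consecutive process events `s`. -/
def jointDensity (f : ℝ → ℝ) {n : ℕ} (s : Fin (n + 1) → ℝ) : ℝ :=
  ∏ i : Fin n, f (s i.succ - s i.castSucc)

/-! ### The observed events -/

/-- The indices in `{1, …, N}` of the process events, i.e. of the events outside `I`. -/
def processIndices (N : ℕ) (I : Finset ℕ) : Finset ℕ := Finset.Icc 1 N \ I

/-- The number `N - K` of process events among the observed ones. -/
def numProcess (N : ℕ) (I : Finset ℕ) : ℕ := (processIndices N I).card

/-- `index N I j` is `k_j`, the `j`-th smallest index of a process event, for `1 ≤ j ≤ N - K`;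
moreover `k_0 = 0` and `k_j = N + 1` for `j > N - K` (so `k_1 = N + 1` if `K = N`). -/
def index (N : ℕ) (I : Finset ℕ) (j : ℕ) : ℕ :=
  if j = 0 then 0
  else if j ≤ numProcess N I then Nat.nth (fun i => i ∈ processIndices N I) (j - 1)
  else N + 1

/-- The complete sequence of process events: the extra event at `x`, the `N - K` observed process
events in their order, and the extra event at `y`. -/
def completeTimes (t : ℕ → ℝ) (N : ℕ) (I : Finset ℕ) (x y : ℝ) :
    Fin (numProcess N I + 1 + 1) → ℝ :=
  fun j => if (j : ℕ) = 0 then x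
    else if (j : ℕ) ≤ numProcess N I then t (index N I j) else y

/-! ### The unnormalized posterior probability -/

/-- The conditional law of the times of the two extra events: their density is proportional to the
joint density of the complete sequence (with the observed process events held fixed), and the extra
events lie outside the window `[ts, te]`, on the two sides of it. -/
def extraLaw (f : ℝ → ℝ) (t : ℕ → ℝ) (ts te : ℝ) (N : ℕ) (I : Finset ℕ) : Measure (ℝ × ℝ) :=
  ProbabilityTheory.cond
    ((volume : Measure (ℝ × ℝ)).withDensity fun q =>
      ENNReal.ofReal (jointDensity f (completeTimes t N I q.1 q.2)))
    (Iic ts ×ˢ Ici te)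

/-- The expected joint density of the intervals of the complete sequence, given the observed process
events and the absence of further process events in the window. -/
def observedDensity (f : ℝ → ℝ) (t : ℕ → ℝ) (ts te : ℝ) (N : ℕ) (I : Finset ℕ) : ℝ :=
  ∫ q, jointDensity f (completeTimes t N I q.1 q.2) ∂extraLaw f t ts te N I

/-- The expected joint density of `K` unobserved independent intervals. -/
def unobservedDensity (f : ℝ → ℝ) (K : ℕ) : ℝ :=
  ∫ τ : Fin K → ℝ, ∏ i, f (τ i) ∂Measure.pi fun _ => intervalLaw f

/-- The unnormalized posterior probability of `I`: prior probability of `I`, times the expected joint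
density of the observed process, times that of the `K` unobserved process events which make up the
number `N` of process events; scaled by the `(N + 1)`-st power of the expected density. -/
def unnormalizedPosterior (f : ℝ → ℝ) (p : unitInterval) (N : ℕ) (ts te : ℝ) (t : ℕ → ℝ)
    (I : Finset ℕ) : ℝ :=
  priorProb p N I * observedDensity f t ts te N I * unobservedDensity f I.card /
    meanDensity f ^ (N + 1)

/-- The law of the length of the interval between consecutive process events that covers
`[ts, te]`. -/
def coverLaw (f : ℝ → ℝ) (ts te : ℝ) : Measure ℝ :=
  (ProbabilityTheory.cond (renewalLaw f 1) {s | s 0 ≤ ts ∧ te ≤ s 1}).map fun s => s 1 - s 0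

/-! ### The factors -/

/-- The factor `P_k`. -/
def factorP (f : ℝ → ℝ) (p : ℝ) (N : ℕ) (ts te : ℝ) (t : ℕ → ℝ) (k : ℕ) : ℝ :=
  (meanDensity f)⁻¹ *
    if k = N + 1 then
      p ^ N * ((∫ τ in Ioi (te - ts), (τ - (te - ts)) * f τ ^ 2) /
        ∫ τ in Ioi (te - ts), (τ - (te - ts)) * f τ)
    else
      p ^ (k - 1) * ((∫ τ in Ioi (t k - ts), f τ ^ 2) / ∫ τ in Ioi (t k - ts), f τ)

/-- The factor `Q_{k, l}`. -/
def factorQ (f : ℝ → ℝ) (p : ℝ) (t : ℕ → ℝ) (k l : ℕ) : ℝ :=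
  (meanDensity f)⁻¹ * ((1 - p) * p ^ (l - k - 1) * f (t l - t k))

/-- The factor `R_k`. -/
def factorR (f : ℝ → ℝ) (p : ℝ) (N : ℕ) (te : ℝ) (t : ℕ → ℝ) (k : ℕ) : ℝ :=
  (meanDensity f)⁻¹ *
    if k = 0 then meanDensity f
    else
      (1 - p) * p ^ (N - k) * ((∫ τ in Ioi (te - t k), f τ ^ 2) / ∫ τ in Ioi (te - t k), f τ)

end Intrusion

end

/-! The prior is `p ^ K * (1 - p) ^ (N - K)`, since the binomial coefficient cancels against the
number of `K`-element subsets, and by independence the `K` unobserved intervals contribute `E ^ K`.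
The substance lies in the observed density: if a law on `A` has density proportional to `g`, the
mean of `g` under it is `∫_A g² / ∫_A g` (`integral_cond_withDensity`).

If some process event is observed, `g(x, y)` is a constant times `f(a - x) * f(y - b)`, with `a` and
`b` the first and last observed process times. Both integrals split, which gives one tail quotient
at each end of the window (`observedDensity_eq`). If none is observed, `g(x, y) = f(y - x)`, and the
pairs `x ≤ ts`, `y ≥ te` at distance `τ` form a segment of length `τ - T`, which produces the weight
in `P_{N+1}` (`map_sub_restrict`). The same computation yields the law of the covering interval.

It remains to distribute powers: those of `p` telescope along the indices (`prod_pow_index`), and `E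
^ K / E ^ (N + 1)` leaves one `E⁻¹` per interval. The joint density of the event times comes from a
unipotent change of variables (`measurePreserving_eventTimes`). -/

namespace Intrusion

/-! ### Integrability and the expected density -/

variable {f : ℝ → ℝ}

theorem IsIntervalDensity.integrable (hf : IsIntervalDensity f) : Integrable f := by
  refine ⟨hf.measurable.aestronglyMeasurable, ?_⟩
  rw [hasFiniteIntegral_iff_ofReal (Filter.Eventually.of_forall hf.nonneg), hf.lintegral_eq_one]
  exact ENNReal.one_lt_top

theorem isProbabilityMeasure_intervalLaw (hf : IsIntervalDensity f) :
    IsProbabilityMeasure (intervalLaw f) :=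
  ⟨by rw [intervalLaw, withDensity_apply _ MeasurableSet.univ, Measure.restrict_univ,
    hf.lintegral_eq_one]⟩

theorem integrable_intervalLaw_iff (hf : IsIntervalDensity f) {g : ℝ → ℝ} :
    Integrable g (intervalLaw f) ↔ Integrable fun τ => g τ * f τ := by
  rw [intervalLaw, integrable_withDensity_iff hf.measurable.ennreal_ofReal (by simp)]
  simp only [ENNReal.toReal_ofReal (hf.nonneg _)]

theorem meanDensity_eq (hf : IsIntervalDensity f) : meanDensity f = ∫ τ, f τ ^ 2 := by
  rw [meanDensity, intervalLaw,
    integral_withDensity_eq_integral_toReal_smul hf.measurable.ennreal_ofReal (by simp)]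
  simp only [ENNReal.toReal_ofReal (hf.nonneg _), smul_eq_mul, sq]

theorem integrable_sq (hf : IsIntervalDensity f) (hfin : Integrable f (intervalLaw f)) :
    Integrable fun τ => f τ ^ 2 := by
  simpa only [sq] using (integrable_intervalLaw_iff hf).1 hfin

/-- If `∫ f² = 0`, then `f` vanishes almost everywhere and cannot have mass one. -/
theorem meanDensity_pos (hf : IsIntervalDensity f) (hfin : Integrable f (intervalLaw f)) :
    0 < meanDensity f := by
  rw [meanDensity_eq hf]
  refine lt_of_le_of_ne (integral_nonneg fun τ => sq_nonneg _) fun h => ?_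
  have h0 := (integral_eq_zero_iff_of_nonneg (fun τ => sq_nonneg (f τ))
    (integrable_sq hf hfin)).1 h.symm
  have h1 : ∫⁻ τ, ENNReal.ofReal (f τ) = 0 := by
    rw [lintegral_eq_zero_iff hf.measurable.ennreal_ofReal]
    filter_upwards [h0] with τ hτ
    have : f τ = 0 := by simpa using hτ
    simp [this]
  exact one_ne_zero (hf.lintegral_eq_one.symm.trans h1)

theorem unobservedDensity_eq (hf : IsIntervalDensity f) (K : ℕ) :
    unobservedDensity f K = meanDensity f ^ K := by
  have := isProbabilityMeasure_intervalLaw hf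
  rw [unobservedDensity, integral_fintype_prod_eq_pow, meanDensity, Fintype.card_fin]

/-! ### The joint density of consecutive events -/

theorem pi_intervalLaw (hf : IsIntervalDensity f) (n : ℕ) :
    Measure.pi (fun _ : Fin n => intervalLaw f) =
      volume.withDensity fun Δ => ENNReal.ofReal (∏ i, f (Δ i)) := by
  have := isProbabilityMeasure_intervalLaw hf
  refine Measure.pi_eq fun s hs => ?_
  rw [withDensity_apply _ (MeasurableSet.univ_pi hs), volume_pi, Measure.restrict_pi_pi,
    ← ofReal_integral_eq_lintegral_ofReal
      (Integrable.fintype_prod (f := fun _ => f) fun _ => hf.integrable.integrableOn)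
      (Filter.Eventually.of_forall fun Δ => Finset.prod_nonneg fun i _ => hf.nonneg _),
    integral_fintype_prod_eq_prod (fun _ => f),
    ENNReal.ofReal_prod_of_nonneg fun i _ => integral_nonneg hf.nonneg]
  refine Finset.prod_congr rfl fun i _ => ?_
  rw [intervalLaw, withDensity_apply _ (hs i), ofReal_integral_eq_lintegral_ofReal
    hf.integrable.integrableOn (Filter.Eventually.of_forall hf.nonneg)]

/-- The matrix which turns intervals into event times. -/
def partialSumMatrix (n : ℕ) : Matrix (Fin (n + 1)) (Fin (n + 1)) ℝ :=
  fun i j => if j ≤ i then 1 else 0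

theorem det_partialSumMatrix (n : ℕ) : (partialSumMatrix n).det = 1 := by
  rw [Matrix.det_of_isLowerTriangular]
  · simp [partialSumMatrix]
  · intro i j hij
    simp only [partialSumMatrix]
    exact if_neg (not_le.2 (by simpa using hij))

theorem toLin_partialSumMatrix {n : ℕ} (c : ℝ) (Δ : Fin n → ℝ) :
    Matrix.toLin' (partialSumMatrix n) (Fin.cons c Δ : Fin (n + 1) → ℝ) = eventTimes c Δ := by
  ext i
  have h : ∀ j : Fin n, j.succ ≤ i ↔ (j : ℕ) < (i : ℕ) := fun j => Nat.succ_le_iff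
  simp [Matrix.mulVec, dotProduct, partialSumMatrix, eventTimes, Fin.sum_univ_succ,
    Finset.sum_filter, h]

/-- Taking partial sums is a triangular linear map with unit diagonal, so its Jacobian is one. -/
theorem measurePreserving_eventTimes (n : ℕ) :
    MeasurePreserving (fun q : ℝ × (Fin n → ℝ) => eventTimes q.1 q.2) := by
  have h1 : MeasurePreserving (Matrix.toLin' (partialSumMatrix n)) := by
    refine ⟨(LinearMap.continuous_on_pi _).measurable, ?_⟩
    rw [Real.map_matrix_volume_pi_eq_smul_volume_pi (by simp [det_partialSumMatrix])]
    simp [det_partialSumMatrix]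
  have h2 := (volume_preserving_piFinSuccAbove (fun _ : Fin (n + 1) => ℝ) 0).symm
  have h := h1.comp h2
  convert h using 1
  ext q : 1
  rw [← toLin_partialSumMatrix]
  simp [MeasurableEquiv.piFinSuccAbove, Fin.insertNthEquiv]

theorem eventTimes_succ_sub {n : ℕ} (c : ℝ) (Δ : Fin n → ℝ) (i : Fin n) :
    eventTimes c Δ i.succ - eventTimes c Δ i.castSucc = Δ i := by
  have : Finset.univ.filter (fun j : Fin n => (j : ℕ) < (i.succ : ℕ)) =
      insert i (Finset.univ.filter fun j : Fin n => (j : ℕ) < (i.castSucc : ℕ)) := by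
    ext j
    simp [Fin.ext_iff]
    omega
  rw [eventTimes, eventTimes, this, Finset.sum_insert (by simp)]
  ring

theorem measurable_jointDensity (hf : IsIntervalDensity f) (n : ℕ) :
    Measurable fun s : Fin (n + 1) → ℝ => jointDensity f s :=
  Finset.measurable_prod _ fun _ _ =>
    hf.measurable.comp ((measurable_pi_apply _).sub (measurable_pi_apply _))

theorem renewalLaw_eq (hf : IsIntervalDensity f) (n : ℕ) :
    renewalLaw f n = volume.withDensity fun s => ENNReal.ofReal (jointDensity f s) := by
  have hmp := measurePreserving_eventTimes n
  have hg : Measurable fun s : Fin (n + 1) → ℝ => ENNReal.ofReal (jointDensity f s) :=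
    (measurable_jointDensity hf n).ennreal_ofReal
  -- Each interval is a difference of consecutive event times, so the density of the intervals is a
  -- function of the event times and can be carried along the volume-preserving map.
  have h : (volume : Measure ℝ).prod (Measure.pi fun _ : Fin n => intervalLaw f) =
      volume.withDensity fun q : ℝ × (Fin n → ℝ) =>
        ENNReal.ofReal (jointDensity f (eventTimes q.1 q.2)) := by
    have hm : Measurable fun Δ : Fin n → ℝ => ENNReal.ofReal (∏ i, f (Δ i)) :=
      (Finset.measurable_prod _ fun i _ =>
        hf.measurable.comp (measurable_pi_apply i)).ennreal_ofReal
    rw [pi_intervalLaw hf, prod_withDensity_right hm]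
    simp only [jointDensity, eventTimes_succ_sub]
    rfl
  ext s hs
  rw [renewalLaw, h, Measure.map_apply hmp.measurable hs,
    withDensity_apply _ (hmp.measurable hs), withDensity_apply _ hs,
    ← hmp.map_eq, setLIntegral_map hs hg hmp.measurable]

/-! ### Conditional laws given by a density -/

theorem cond_withDensity {α : Type*} [MeasurableSpace α] {μ : Measure α} [SFinite μ] {g : α → ℝ}
    (hg0 : ∀ x, 0 ≤ g x) (s : Set α) (hi : IntegrableOn g s μ) :
    ProbabilityTheory.cond (μ.withDensity fun x => ENNReal.ofReal (g x)) s =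
      (ENNReal.ofReal (∫ x in s, g x ∂μ))⁻¹ •
        (μ.restrict s).withDensity fun x => ENNReal.ofReal (g x) := by
  rw [ProbabilityTheory.cond, restrict_withDensity', withDensity_apply',
    ofReal_integral_eq_lintegral_ofReal hi (Filter.Eventually.of_forall hg0)]

/-- The conditional law already carries one factor `g`, so integrating `g` yields `g²`. A zero
denominator is covered: `(0⁻¹ : ENNReal).toReal = 0` agrees with real division by zero. -/
theorem integral_cond_withDensity {α : Type*} [MeasurableSpace α] {μ : Measure α} [SFinite μ]
    {g : α → ℝ} (hg : Measurable g) (hg0 : ∀ x, 0 ≤ g x) (s : Set α) (hi : IntegrableOn g s μ) :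
    ∫ x, g x ∂ProbabilityTheory.cond (μ.withDensity fun x => ENNReal.ofReal (g x)) s =
      (∫ x in s, g x ^ 2 ∂μ) / ∫ x in s, g x ∂μ := by
  rw [cond_withDensity hg0 s hi, integral_smul_measure,
    integral_withDensity_eq_integral_toReal_smul hg.ennreal_ofReal (by simp)]
  simp only [ENNReal.toReal_ofReal (hg0 _), smul_eq_mul, ← sq, ENNReal.toReal_inv,
    ENNReal.toReal_ofReal (integral_nonneg hg0)]
  rw [div_eq_inv_mul]

/-! ### The two extra events -/

/-- The law of the distance between points on the two sides of the window. -/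
theorem map_sub_restrict (a b : ℝ) :
    ((volume : Measure (ℝ × ℝ)).restrict (Iic a ×ˢ Ici b)).map (fun q => q.2 - q.1) =
      volume.withDensity fun τ => ENNReal.ofReal (τ - (b - a)) := by
  have hmp : MeasurePreserving (fun q : ℝ × ℝ => (q.1, q.2 - q.1)) (volume.prod volume)
      (volume.prod volume) := by
    exact measurePreserving_prod_sub volume volume
  ext s hs
  have hm : Measurable fun q : ℝ × ℝ => q.2 - q.1 := by fun_prop
  have hset : MeasurableSet {q : ℝ × ℝ | q.1 ≤ a ∧ b ≤ q.2 + q.1 ∧ q.2 ∈ s} :=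
    (measurableSet_le measurable_fst measurable_const).inter
      ((measurableSet_le measurable_const (measurable_snd.add measurable_fst)).inter
        (measurable_snd hs))
  have hpre : (fun q : ℝ × ℝ => q.2 - q.1) ⁻¹' s ∩ Iic a ×ˢ Ici b =
      (fun q : ℝ × ℝ => (q.1, q.2 - q.1)) ⁻¹' {q | q.1 ≤ a ∧ b ≤ q.2 + q.1 ∧ q.2 ∈ s} := by
    ext q
    simp only [mem_inter_iff, mem_preimage, mem_prod, mem_Iic, mem_Ici, mem_ofPred_eq,
      sub_add_cancel]
    tauto
  rw [Measure.map_apply hm hs, Measure.restrict_apply (hm hs), hpre, Measure.volume_eq_prod,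
    hmp.measure_preimage hset.nullMeasurableSet, Measure.prod_apply_symm hset,
    withDensity_apply _ hs, ← lintegral_indicator hs]
  refine lintegral_congr fun τ => ?_
  by_cases hτ : τ ∈ s
  -- After the shear, the left points compatible with a given distance `τ` form an interval; for `τ
  -- < b - a` it is empty, in accordance with the truncation by `ENNReal.ofReal`.
  · have : (fun x : ℝ => (x, τ)) ⁻¹' {q | q.1 ≤ a ∧ b ≤ q.2 + q.1 ∧ q.2 ∈ s} =
        Icc (b - τ) a := by
      ext x
      simp only [mem_preimage, mem_ofPred_eq, mem_Icc, hτ, and_true]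
      constructor <;> rintro ⟨h1, h2⟩ <;> constructor <;> linarith
    rw [this, Real.volume_Icc, indicator_of_mem hτ]
    congr 1
    ring
  · simp [hτ]

theorem setIntegral_sub (h : ℝ → ℝ) (hm : Measurable h) (a b : ℝ) :
    ∫ q in Iic a ×ˢ Ici b, h (q.2 - q.1) = ∫ τ in Ioi (b - a), (τ - (b - a)) * h τ := by
  rw [← integral_map (φ := fun q : ℝ × ℝ => q.2 - q.1) (by fun_prop)
    hm.aestronglyMeasurable, map_sub_restrict,
    integral_withDensity_eq_integral_toReal_smul (by fun_prop) (by simp),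
    ← integral_indicator measurableSet_Ioi]
  refine integral_congr_ae (Filter.Eventually.of_forall fun τ => ?_)
  by_cases hτ : b - a < τ
  · simp [hτ, ENNReal.toReal_ofReal (sub_nonneg.2 hτ.le)]
  · simp [hτ, ENNReal.ofReal_of_nonpos (sub_nonpos.2 (not_lt.1 hτ))]

theorem integrableOn_sub (h : ℝ → ℝ) (hm : Measurable h) (a b : ℝ) (h1 : Integrable h)
    (h2 : Integrable fun τ => τ * h τ) :
    IntegrableOn (fun q : ℝ × ℝ => h (q.2 - q.1)) (Iic a ×ˢ Ici b) := by
  have : Integrable h (((volume : Measure (ℝ × ℝ)).restrict (Iic a ×ˢ Ici b)).map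
      fun q => q.2 - q.1) := by
    rw [map_sub_restrict, integrable_withDensity_iff (by fun_prop) (by simp)]
    -- The truncated weight `max (τ - (b - a)) 0` is dominated by `|τ - (b - a)|`.
    refine (h2.sub (h1.const_mul (b - a))).mono (by fun_prop)
      (Filter.Eventually.of_forall fun τ => ?_)
    have e : τ * h τ - (b - a) * h τ = h τ * (τ - (b - a)) := by ring
    simp only [Pi.sub_apply, e, norm_mul, ENNReal.toReal_ofReal']
    gcongr
    rw [Real.norm_eq_abs, Real.norm_eq_abs, abs_of_nonneg (le_max_right _ _)]
    exact max_le (le_abs_self _) (abs_nonneg _)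
  exact (integrable_map_measure hm.aestronglyMeasurable (by fun_prop)).1 this

theorem setIntegral_Iic_sub_left (h : ℝ → ℝ) (a c : ℝ) :
    ∫ x in Iic a, h (c - x) = ∫ τ in Ioi (c - a), h τ := by
  rw [← integral_Ici_eq_integral_Ioi, ← integral_indicator measurableSet_Iic,
    ← integral_indicator measurableSet_Ici, ← integral_sub_left_eq_self _ volume c]
  refine integral_congr_ae (Filter.Eventually.of_forall fun x => ?_)
  simp [indicator, add_comm]

theorem setIntegral_Ici_sub_right (h : ℝ → ℝ) (b c : ℝ) :
    ∫ y in Ici b, h (y - c) = ∫ τ in Ioi (b - c), h τ := by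
  rw [← integral_Ici_eq_integral_Ioi, ← integral_indicator measurableSet_Ici,
    ← integral_indicator measurableSet_Ici, ← integral_add_right_eq_self _ c]
  refine integral_congr_ae (Filter.Eventually.of_forall fun x => ?_)
  simp [indicator]

theorem integral_cond_intervalLaw (hf : IsIntervalDensity f) (a : ℝ) :
    ∫ τ, f τ ∂ProbabilityTheory.cond (intervalLaw f) (Ici a) =
      (∫ τ in Ioi a, f τ ^ 2) / ∫ τ in Ioi a, f τ := by
  rw [intervalLaw, integral_cond_withDensity hf.measurable hf.nonneg _ hf.integrable.integrableOn,
    integral_Ici_eq_integral_Ioi, integral_Ici_eq_integral_Ioi]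

/-! ### The interval covering the window -/

theorem map_withDensity_comp {α β : Type*} [MeasurableSpace α] [MeasurableSpace β] (μ : Measure α)
    {φ : α → β} (hφ : Measurable φ) {h : β → ENNReal} (hh : Measurable h) :
    (μ.withDensity fun x => h (φ x)).map φ = (μ.map φ).withDensity h := by
  ext s hs
  rw [Measure.map_apply hφ hs, withDensity_apply _ (hφ hs), withDensity_apply _ hs,
    setLIntegral_map hs hh hφ]

theorem coverLaw_eq (hf : IsIntervalDensity f) (h1 : Integrable (fun τ => τ) (intervalLaw f))
    (ts te : ℝ) :
    coverLaw f ts te = volume.withDensity fun τ => ENNReal.ofReal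
      ((τ - (te - ts)) * f τ / ∫ σ in Ioi (te - ts), (σ - (te - ts)) * f σ) := by
  have he := volume_preserving_finTwoArrow ℝ
  have hS : MeasurableSet (Iic ts ×ˢ Ici te : Set (ℝ × ℝ)) :=
    measurableSet_Iic.prod measurableSet_Ici
  have hset : {s : Fin (1 + 1) → ℝ | s 0 ≤ ts ∧ te ≤ s 1} =
      MeasurableEquiv.finTwoArrow ⁻¹' (Iic ts ×ˢ Ici te : Set (ℝ × ℝ)) := by
    ext s
    simp [MeasurableEquiv.finTwoArrow]
  have hlaw : renewalLaw f 1 = (volume : Measure (Fin 2 → ℝ)).withDensity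
      fun s => ENNReal.ofReal (f (s 1 - s 0)) := by
    rw [renewalLaw_eq hf]
    simp [jointDensity]
  have hi : IntegrableOn (fun s : Fin 2 → ℝ => f (s 1 - s 0))
      (MeasurableEquiv.finTwoArrow ⁻¹' (Iic ts ×ˢ Ici te : Set (ℝ × ℝ))) :=
    (he.integrableOn_comp_preimage (MeasurableEquiv.measurableEmbedding _)).2
      (integrableOn_sub f hf.measurable ts te hf.integrable ((integrable_intervalLaw_iff hf).1 h1))
  have hZ : ∫ s in MeasurableEquiv.finTwoArrow ⁻¹' (Iic ts ×ˢ Ici te : Set (ℝ × ℝ)),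
      f (s 1 - s 0) = ∫ σ in Ioi (te - ts), (σ - (te - ts)) * f σ := by
    rw [← setIntegral_sub f hf.measurable]
    exact he.setIntegral_preimage_emb (MeasurableEquiv.measurableEmbedding _)
      (fun q : ℝ × ℝ => f (q.2 - q.1)) _
  have hZ0 : 0 ≤ ∫ σ in Ioi (te - ts), (σ - (te - ts)) * f σ :=
    hZ ▸ integral_nonneg fun s => hf.nonneg _
  have hmap : ((volume : Measure (Fin 2 → ℝ)).restrict
      (MeasurableEquiv.finTwoArrow ⁻¹' (Iic ts ×ˢ Ici te : Set (ℝ × ℝ)))).map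
        (fun s => s 1 - s 0) = volume.withDensity fun τ => ENNReal.ofReal (τ - (te - ts)) := by
    rw [← map_sub_restrict, ← (he.restrict_preimage hS).map_eq,
      Measure.map_map (by fun_prop) he.measurable]
    rfl
  rw [coverLaw, hset, hlaw]
  set Z := ∫ σ in Ioi (te - ts), (σ - (te - ts)) * f σ with hZdef
  -- If `Z = 0`, conditioning on a null event gives the zero measure, and the claimed density is
  -- zero through division by zero.
  rcases hZ0.eq_or_lt with h0 | h0
  · rw [ProbabilityTheory.cond_eq_zero_of_meas_eq_zero]
    · simp [← h0]
    · rw [withDensity_apply', ← ofReal_integral_eq_lintegral_ofReal hi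
        (Filter.Eventually.of_forall fun s => hf.nonneg _), hZ, ← h0, ENNReal.ofReal_zero]
  · rw [cond_withDensity (fun s => hf.nonneg _) _ hi, hZ, Measure.map_smul,
      map_withDensity_comp _ (by fun_prop) hf.measurable.ennreal_ofReal, hmap,
      ← withDensity_mul _ (by fun_prop) hf.measurable.ennreal_ofReal,
      ← withDensity_smul _ (Measurable.mul (by fun_prop) hf.measurable.ennreal_ofReal)]
    congr 1
    ext τ
    rw [Pi.smul_apply, Pi.mul_apply, smul_eq_mul, ← ENNReal.ofReal_inv_of_pos h0,
      ← ENNReal.ofReal_mul' (hf.nonneg τ), ← ENNReal.ofReal_mul (inv_nonneg.2 hZ0)]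
    congr 1
    ring

theorem integral_coverLaw (hf : IsIntervalDensity f)
    (h1 : Integrable (fun τ => τ) (intervalLaw f)) (ts te : ℝ) :
    ∫ τ, f τ ∂coverLaw f ts te = (∫ τ in Ioi (te - ts), (τ - (te - ts)) * f τ ^ 2) /
        ∫ τ in Ioi (te - ts), (τ - (te - ts)) * f τ := by
  have hZ0 : 0 ≤ ∫ σ in Ioi (te - ts), (σ - (te - ts)) * f σ :=
    setIntegral_nonneg measurableSet_Ioi fun τ hτ =>
      mul_nonneg (sub_nonneg.2 (le_of_lt hτ)) (hf.nonneg τ)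
  have hm := hf.measurable
  rw [coverLaw_eq hf h1]
  generalize ∫ σ in Ioi (te - ts), (σ - (te - ts)) * f σ = Z at hZ0 ⊢
  rw [integral_withDensity_eq_integral_toReal_smul (by fun_prop) (by simp), ← integral_div,
    ← integral_indicator measurableSet_Ioi]
  refine integral_congr_ae (Filter.Eventually.of_forall fun τ => ?_)
  by_cases hτ : te - ts < τ
  · rw [indicator_of_mem (mem_Ioi.2 hτ)]
    simp only [smul_eq_mul]
    rw [ENNReal.toReal_ofReal
      (div_nonneg (mul_nonneg (sub_nonneg.2 hτ.le) (hf.nonneg τ)) hZ0)]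
    ring
  · rw [indicator_of_notMem (by simpa using hτ)]
    simp only [smul_eq_mul]
    rw [ENNReal.ofReal_of_nonpos (div_nonpos_of_nonpos_of_nonneg
      (mul_nonpos_of_nonpos_of_nonneg (sub_nonpos.2 (not_lt.1 hτ)) (hf.nonneg τ)) hZ0)]
    simp

/-! ### The indices of the process events -/

section Index

variable {N : ℕ} {I : Finset ℕ} {j : ℕ}

theorem numProcess_add_card (hI : I ⊆ Finset.Icc 1 N) : numProcess N I + I.card = N := by
  rw [numProcess, processIndices, Finset.card_sdiff_add_card_eq_card hI, Nat.card_Icc]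
  omega

theorem eq_Icc_of_numProcess_eq_zero (hI : I ⊆ Finset.Icc 1 N) (h : numProcess N I = 0) :
    I = Finset.Icc 1 N :=
  hI.antisymm (Finset.sdiff_eq_empty_iff_subset.1 (Finset.card_eq_zero.1 h))

theorem index_zero : index N I 0 = 0 := if_pos rfl

theorem index_succ (hj : j < numProcess N I) :
    index N I (j + 1) = Nat.nth (fun i => i ∈ processIndices N I) j := by
  simp [index, hj]

theorem index_of_lt (hj : numProcess N I < j) : index N I j = N + 1 := by
  simp [index, Nat.ne_of_gt (Nat.zero_lt_of_lt hj), hj]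

theorem finite_processIndices : (Set.ofPred fun i => i ∈ processIndices N I).Finite :=
  (processIndices N I).finite_toSet

theorem card_finite_processIndices :
    (finite_processIndices (N := N) (I := I)).toFinset.card = numProcess N I := by
  rw [numProcess]
  congr 1
  ext i
  simp

theorem index_mem (h1 : 1 ≤ j) (hj : j ≤ numProcess N I) :
    index N I j ∈ Finset.Icc 1 N := by
  obtain ⟨i, rfl⟩ := Nat.exists_eq_add_of_le' h1
  rw [index_succ hj]
  exact (Finset.mem_sdiff.1 (Nat.nth_mem_of_lt_card
    (p := fun i => i ∈ processIndices N I) finite_processIndices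
    (card_finite_processIndices.symm ▸ hj))).1

theorem index_lt_succ (h1 : 1 ≤ j) (hj : j < numProcess N I) :
    index N I j < index N I (j + 1) := by
  obtain ⟨i, rfl⟩ := Nat.exists_eq_add_of_le' h1
  rw [index_succ hj, index_succ (Nat.lt_of_succ_lt hj)]
  exact Nat.nth_lt_nth_of_lt_card finite_processIndices (Nat.lt_succ_self i)
    (card_finite_processIndices.symm ▸ hj)

theorem le_index (h1 : 1 ≤ j) (hj : j ≤ numProcess N I) : j ≤ index N I j := by
  induction j, h1 using Nat.le_induction with
  | base => exact (Finset.mem_Icc.1 (index_mem le_rfl hj)).1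
  | succ j h1 ih => exact (ih (Nat.le_of_succ_le hj)).trans_lt (index_lt_succ h1 hj)

/-- The exponents count the intrusion events in successive gaps; together these are the `k_j - j`
intrusion events before `k_j`. -/
theorem prod_pow_index (p : ℝ) (h1 : 1 ≤ j) (hj : j ≤ numProcess N I) :
    p ^ (index N I 1 - 1) * ∏ i ∈ Finset.Ico 1 j, p ^ (index N I (i + 1) - index N I i - 1) =
      p ^ (index N I j - j) := by
  induction j, h1 using Nat.le_induction with
  | base => simp
  | succ j h1 ih =>
    rw [Finset.prod_Ico_succ_top h1, ← mul_assoc, ih (Nat.le_of_succ_le hj), ← pow_add]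
    -- These bounds keep the natural-number subtractions in the exponents from truncating.
    have := le_index h1 (Nat.le_of_succ_le hj)
    have := index_lt_succ h1 hj
    congr 1
    omega

end Index

/-! ### The posterior probability -/

theorem priorProb_eq (p : unitInterval) {N : ℕ} {I : Finset ℕ} (hI : I ⊆ Finset.Icc 1 N) :
    priorProb p N I = (p : ℝ) ^ I.card * (1 - (p : ℝ)) ^ numProcess N I := by
  have hN := numProcess_add_card hI
  have h0 : (N.choose I.card : ℝ) ≠ 0 :=
    Nat.cast_ne_zero.2 (Nat.choose_pos (by omega)).ne'
  rw [priorProb, if_pos hI, ProbabilityTheory.binomial_real_singleton, Finset.card_powersetCard,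
    Nat.card_Icc, Nat.add_sub_cancel, show N - I.card = numProcess N I by omega]
  field_simp

theorem jointDensity_completeTimes_of_eq_zero (f : ℝ → ℝ) (t : ℕ → ℝ) {N : ℕ} {I : Finset ℕ}
    (h : numProcess N I = 0) (x y : ℝ) :
    jointDensity f (completeTimes t N I x y) = f (y - x) := by
  simp only [jointDensity, completeTimes, Fin.val_succ, Fin.val_castSucc]
  rw [Finset.prod_fin_eq_prod_range]
  simp [h]

theorem jointDensity_completeTimes (f : ℝ → ℝ) (t : ℕ → ℝ) {N : ℕ} {I : Finset ℕ}
    (h : 1 ≤ numProcess N I) (x y : ℝ) :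
    jointDensity f (completeTimes t N I x y) =
      (∏ j ∈ Finset.Ico 1 (numProcess N I), f (t (index N I (j + 1)) - t (index N I j))) *
        (f (t (index N I 1) - x) * f (y - t (index N I (numProcess N I)))) := by
  -- Indexing the times by `ℕ` turns the product over `Fin` into one over a range, from which the
  -- two boundary factors can be split off.
  obtain ⟨s, hs⟩ : ∃ s : ℕ → ℝ, s = fun j => if j = 0 then x
    else if j ≤ numProcess N I then t (index N I j) else y := ⟨_, rfl⟩
  have hjoint : jointDensity f (completeTimes t N I x y) =
      ∏ j ∈ Finset.range (numProcess N I + 1), f (s (j + 1) - s j) := by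
    rw [Finset.prod_range, hs]
    rfl
  rw [hjoint, Finset.range_eq_Ico, Finset.prod_Ico_succ_top (Nat.zero_le _),
    Finset.prod_eq_prod_Ico_succ_bot h]
  have hs1 : ∀ j, 1 ≤ j → j ≤ numProcess N I → s j = t (index N I j) := fun j h1 h2 => by
    simp [hs, h2, Nat.one_le_iff_ne_zero.1 h1]
  have hs0 : s 0 = x := by simp [hs]
  have hy : s (numProcess N I + 1) = y := by simp [hs]
  rw [zero_add, hs0, hy, hs1 1 le_rfl h, hs1 _ h le_rfl]
  have : ∏ j ∈ Finset.Ico 1 (numProcess N I), f (s (j + 1) - s j) =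
      ∏ j ∈ Finset.Ico 1 (numProcess N I), f (t (index N I (j + 1)) - t (index N I j)) :=
    Finset.prod_congr rfl fun j hj => by
      obtain ⟨h1, h2⟩ := Finset.mem_Ico.1 hj
      rw [hs1 j h1 h2.le, hs1 (j + 1) (by omega) h2]
  rw [this]
  ring

theorem observedDensity_of_eq_zero (hf : IsIntervalDensity f) (t : ℕ → ℝ) (ts te : ℝ) {N : ℕ}
    {I : Finset ℕ} (h : numProcess N I = 0) (h1 : Integrable (fun τ => τ) (intervalLaw f)) :
    observedDensity f t ts te N I = (∫ τ in Ioi (te - ts), (τ - (te - ts)) * f τ ^ 2) /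
        ∫ τ in Ioi (te - ts), (τ - (te - ts)) * f τ := by
  have hm := hf.measurable
  simp only [observedDensity, extraLaw, jointDensity_completeTimes_of_eq_zero f t h]
  rw [integral_cond_withDensity (g := fun q : ℝ × ℝ => f (q.2 - q.1)) (by fun_prop)
      (fun q => hf.nonneg _) _ (integrableOn_sub f hm ts te hf.integrable
        ((integrable_intervalLaw_iff hf).1 h1)),
    setIntegral_sub f hm, setIntegral_sub (fun τ => f τ ^ 2) (by fun_prop)]

theorem observedDensity_eq (hf : IsIntervalDensity f) (t : ℕ → ℝ) (ts te : ℝ) {N : ℕ}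
    {I : Finset ℕ} (h : 1 ≤ numProcess N I) :
    observedDensity f t ts te N I =
      (∏ j ∈ Finset.Ico 1 (numProcess N I), f (t (index N I (j + 1)) - t (index N I j))) *
        ((∫ τ in Ioi (t (index N I 1) - ts), f τ ^ 2) /
            (∫ τ in Ioi (t (index N I 1) - ts), f τ) *
          ((∫ τ in Ioi (te - t (index N I (numProcess N I))), f τ ^ 2) /
            ∫ τ in Ioi (te - t (index N I (numProcess N I))), f τ)) := by
  have hm := hf.measurable
  simp only [observedDensity, extraLaw, jointDensity_completeTimes f t h]
  generalize hC : (∏ j ∈ Finset.Ico 1 (numProcess N I),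
    f (t (index N I (j + 1)) - t (index N I j))) = C
  have hC0 : 0 ≤ C := hC ▸ Finset.prod_nonneg fun j _ => hf.nonneg _
  generalize t (index N I 1) = a
  generalize t (index N I (numProcess N I)) = b
  have hi : Integrable fun q : ℝ × ℝ => C * (f (a - q.1) * f (q.2 - b)) :=
    ((hf.integrable.comp_sub_left a).mul_prod (hf.integrable.comp_sub_right b)).const_mul C
  rw [integral_cond_withDensity (g := fun q : ℝ × ℝ => C * (f (a - q.1) * f (q.2 - b)))
    (by fun_prop) (fun q => mul_nonneg hC0 (mul_nonneg (hf.nonneg _) (hf.nonneg _))) _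
    hi.integrableOn]
  simp only [mul_pow]
  -- The final cancellation `C * C / C = C` also holds for `C = 0`.
  rw [integral_const_mul, integral_const_mul, Measure.volume_eq_prod,
    setIntegral_prod_mul (fun x => f (a - x)) (fun y => f (y - b)),
    setIntegral_prod_mul (fun x => f (a - x) ^ 2) (fun y => f (y - b) ^ 2),
    setIntegral_Iic_sub_left f, setIntegral_Iic_sub_left (fun τ => f τ ^ 2),
    setIntegral_Ici_sub_right f, setIntegral_Ici_sub_right (fun τ => f τ ^ 2),
    mul_div_mul_comm, mul_div_mul_comm, sq, mul_self_div_self]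

theorem prod_factorQ (f : ℝ → ℝ) (p : ℝ) (t : ℕ → ℝ) (N : ℕ) (I : Finset ℕ) :
    ∏ j ∈ Finset.Ico 1 (numProcess N I), factorQ f p t (index N I j) (index N I (j + 1)) =
      (meanDensity f)⁻¹ ^ (numProcess N I - 1) * (1 - p) ^ (numProcess N I - 1) *
        (∏ j ∈ Finset.Ico 1 (numProcess N I), p ^ (index N I (j + 1) - index N I j - 1)) *
        ∏ j ∈ Finset.Ico 1 (numProcess N I), f (t (index N I (j + 1)) - t (index N I j)) := by
  simp only [factorQ, Finset.prod_mul_distrib, Finset.prod_const, Nat.card_Ico]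
  ring

theorem unnormalizedPosterior_eq (hf : IsIntervalDensity f) (hfin : Integrable f (intervalLaw f))
    (p : unitInterval) (N : ℕ) (ts te : ℝ) (t : ℕ → ℝ) {I : Finset ℕ} (hI : I ⊆ Finset.Icc 1 N)
    (hmean : I = Finset.Icc 1 N → Integrable (fun τ => τ) (intervalLaw f)) :
    unnormalizedPosterior f p N ts te t I =
      factorP f p N ts te t (index N I 1) *
        (∏ j ∈ Finset.Ico 1 (numProcess N I),
          factorQ f p t (index N I j) (index N I (j + 1))) *
        factorR f p N te t (index N I (numProcess N I)) := by
  have hE := (meanDensity_pos hf hfin).ne'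
  have hN := numProcess_add_card hI
  rw [unnormalizedPosterior, priorProb_eq p hI, unobservedDensity_eq hf]
  rcases Nat.eq_zero_or_pos (numProcess N I) with h0 | hpos
  · rw [observedDensity_of_eq_zero hf t ts te h0 (hmean (eq_Icc_of_numProcess_eq_zero hI h0)),
      h0, index_zero, index_of_lt (h0 ▸ Nat.one_pos), factorP, if_pos rfl, factorR, if_pos rfl,
      show I.card = N by omega]
    simp only [pow_zero, Finset.Ico_eq_empty_of_le (Nat.zero_le 1), Finset.prod_empty]
    field_simp
    ring
  · have hk1 := Finset.mem_Icc.1 (index_mem le_rfl hpos)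
    have hkM := Finset.mem_Icc.1 (index_mem hpos le_rfl)
    have hle := le_index hpos le_rfl
    have hpow : (p : ℝ) ^ I.card = (p : ℝ) ^ (index N I 1 - 1) *
        (∏ j ∈ Finset.Ico 1 (numProcess N I),
          (p : ℝ) ^ (index N I (j + 1) - index N I j - 1)) *
        (p : ℝ) ^ (N - index N I (numProcess N I)) := by
      rw [prod_pow_index _ hpos le_rfl, ← pow_add]
      congr 1
      omega
    rw [observedDensity_eq hf t ts te hpos, prod_factorQ, factorP, if_neg (by omega), factorR,
      if_neg (by omega), hpow,
      show N + 1 = I.card + (numProcess N I - 1) + 2 by omega,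
      show (1 - (p : ℝ)) ^ numProcess N I =
        (1 - (p : ℝ)) ^ (numProcess N I - 1) * (1 - (p : ℝ)) by
          rw [← pow_succ, Nat.sub_add_cancel hpos]]
    have hquot : meanDensity f ^ I.card / meanDensity f ^ (I.card + (numProcess N I - 1) + 2) =
        (meanDensity f)⁻¹ * (meanDensity f)⁻¹ ^ (numProcess N I - 1) * (meanDensity f)⁻¹ := by
      rw [pow_add, pow_add, inv_pow]
      field_simp
    rw [mul_div_assoc, hquot]
    ring

end Intrusion

open Intrusion in
theorem lemma1
    -- the interval density, with a finite expected density
    (f : ℝ → ℝ) (hf : IsIntervalDensity f) (hfin : Integrable f (intervalLaw f))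
    -- the prior probability that an event belongs to the intrusion
    (p : unitInterval)
    -- the window and the observed events
    (N : ℕ) (ts te : ℝ) (hT : ts ≤ te) (t : ℕ → ℝ)
    (ht : ∀ i ∈ Set.Icc 1 N, t i ∈ Set.Icc ts te) (hmono : MonotoneOn t (Set.Icc 1 N)) :
    -- the joint density of the process events produced by the generative model
    (∀ n : ℕ, renewalLaw f n =
      volume.withDensity fun s => ENNReal.ofReal (jointDensity f s)) ∧
    -- the unnormalized posterior probability of every intrusion subsequence
    (∀ I : Finset ℕ, I ⊆ Finset.Icc 1 N →
      (I = Finset.Icc 1 N → Integrable (fun τ => τ) (intervalLaw f) ∧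
        Integrable (fun τ => τ * f τ) (intervalLaw f)) →
      unnormalizedPosterior f p N ts te t I =
        factorP f p N ts te t (index N I 1) *
          (∏ j ∈ Finset.Ico 1 (numProcess N I),
            factorQ f p t (index N I j) (index N I (j + 1))) *
          factorR f p N te t (index N I (numProcess N I))) ∧
    -- the first and the last factor as transitions from and to an extra event
    (∀ k ∈ Set.Icc 1 N,
      factorP f p N ts te t k = (meanDensity f)⁻¹ * ((p : ℝ) ^ (k - 1) *
        ∫ τ, f τ ∂ProbabilityTheory.cond (intervalLaw f) (Ici (t k - ts))) ∧
      factorR f p N te t k = (meanDensity f)⁻¹ * ((1 - (p : ℝ)) * (p : ℝ) ^ (N - k) *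
        ∫ τ, f τ ∂ProbabilityTheory.cond (intervalLaw f) (Ici (te - t k)))) ∧
    -- the interval covering the window: its density (observation paradox), and the first factor
    -- if all events belong to the intrusion as a transition over this interval
    (Integrable (fun τ => τ) (intervalLaw f) →
      coverLaw f ts te = volume.withDensity (fun τ => ENNReal.ofReal
        ((τ - (te - ts)) * f τ / ∫ σ in Ioi (te - ts), (σ - (te - ts)) * f σ)) ∧
      (Integrable (fun τ => τ * f τ) (intervalLaw f) →
        factorP f p N ts te t (N + 1) = (meanDensity f)⁻¹ * ((p : ℝ) ^ N *
          ∫ τ, f τ ∂coverLaw f ts te))) := by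
  refine ⟨renewalLaw_eq hf, fun I hI h => unnormalizedPosterior_eq hf hfin p N ts te t hI
    fun hIS => (h hIS).1, fun k hk => ?_, fun h1 => ⟨coverLaw_eq hf h1 ts te, fun _ => ?_⟩⟩
  · rw [integral_cond_intervalLaw hf, integral_cond_intervalLaw hf, factorP, factorR,
      if_neg (by have := hk.2; omega), if_neg (by have := hk.1; omega)]
    exact ⟨rfl, rfl⟩
  · rw [integral_coverLaw hf h1, factorP, if_pos rfl]
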